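/- Let $G$ be a finite tree with vertex set $V$, let $K$ be a field, and let $R=K[x_v : v\in V]$. A set $S\subseteq V$ is called dominating if $S\cap N[v]\neq\emptyset$ for every $v\in V$, where $N[v]=\{u\in V: \{u,v\}\in E(G)\}\cup\{v\}$, and a minimal dominating set is a dominating set that does not properly contain any other dominating set. Let $$DI(G)=\Big(\prod_{i\in S}x_i \;:\; S \text{ is a minimal dominating set of } G\Big)\subseteq R$$ be the dominating ideal of $G$. Then $DI(G)$ is normally torsion-free, that is, $\mathrm{Ass}_R(R/DI(G)^k)\subseteq \mathrm{Ass}_R(R/DI(G))$ for all $k\geq 1$. -/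

import Mathlib

/-- The closed neighborhood `N[v] = {u | u is adjacent to v} ∪ {v}` of a vertex. -/
def SimpleGraph.closedNeighborSet {V : Type*} (G : SimpleGraph V) (v : V) : Set V :=
  G.neighborSet v ∪ {v}

/-- A set `S` of vertices is dominating if it meets every closed neighborhood. -/
def SimpleGraph.IsDominatingSet {V : Type*} (G : SimpleGraph V) (S : Finset V) : Prop :=
  ∀ v : V, ((S : Set V) ∩ G.closedNeighborSet v).Nonempty

/-- A dominating set is minimal if it does not properly contain any other dominating set. -/
def SimpleGraph.IsMinimalDominatingSet {V : Type*} (G : SimpleGraph V) (S : Finset V) : Prop :=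
  Minimal G.IsDominatingSet S

/-- The dominating ideal of a finite graph: the ideal of `K[x_v : v ∈ V]` generated by the
monomials `∏ i ∈ S, x_i`, where `S` runs over the minimal dominating sets. -/
noncomputable def SimpleGraph.dominatingIdeal {V : Type*} (K : Type*) [Field K]
    (G : SimpleGraph V) : Ideal (MvPolynomial V K) :=
  Ideal.span {m | ∃ S : Finset V, G.IsMinimalDominatingSet S ∧ m = ∏ i ∈ S, MvPolynomial.X i}

/-- An ideal `I` of `R` is normally torsion-free if `Ass(R/I^k) ⊆ Ass(R/I)` for all `k ≥ 1`. -/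
def Ideal.IsNormallyTorsionFree {R : Type*} [CommRing R] (I : Ideal R) : Prop :=
  ∀ k : ℕ, 1 ≤ k → associatedPrimes R (R ⧸ I ^ k) ⊆ associatedPrimes R (R ⧸ I)

open Finset

/-! Let Q(v, k) be spanned by the monomials of degree at least k in the variables of N[v]. The core
is that DI(G)^k is the intersection of the Q(v, k) (`IsTree.mem_dominatingIdeal_pow_iff`). The
nontrivial inclusion asks that a monomial of degree at least k on every N[v] be divisible by a
product of k dominating sets; this is a colouring problem, solved on a tree level by level from a
root (`IsTree.exists_colouring_closedNeighborSet`). Each Q(v, k) is primary to the prime Q(v, 1), so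
an associated prime of DI(G)^k is some Q(v, 1). It is minimal over DI(G), hence associated to it:
passing to a smaller N[u] only shrinks Q(u, k). -/

theorem SimpleGraph.IsAcyclic.eq_of_adj_of_dist_eq {V : Type*} {G : SimpleGraph V}
    (hG : G.IsAcyclic) {r u v w : V} (hu : G.Reachable r u) (hv : G.Reachable r v)
    (huw : G.Adj u w) (hvw : G.Adj v w)
    (hdu : G.dist r w = G.dist r u + 1) (hdv : G.dist r w = G.dist r v + 1) : u = v := by
  obtain ⟨p, hp⟩ := hu.exists_walk_length_eq_dist
  obtain ⟨q, hq⟩ := hv.exists_walk_length_eq_dist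
  have hp' : (p.concat huw).IsPath :=
    SimpleGraph.Walk.isPath_of_length_eq_dist _ (by simp [hp, hdu])
  have hq' : (q.concat hvw).IsPath :=
    SimpleGraph.Walk.isPath_of_length_eq_dist _ (by simp [hq, hdv])
  have h := congrArg (fun x : G.Path r w ↦ x.1.penultimate)
    ((hG.subsingleton_path r w).elim ⟨_, hp'⟩ ⟨_, hq'⟩)
  simpa using h

/-- A set covered by capacities can be split into parts respecting the capacities. -/
theorem Finset.exists_biUnion_eq_of_card_le_sum {ι α : Type*} [DecidableEq α]
    (s : Finset ι) (a : ι → ℕ) (M : Finset α) (h : #M ≤ ∑ i ∈ s, a i) :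
    ∃ f : ι → Finset α, (∀ i, f i ⊆ M ∧ #(f i) ≤ a i) ∧ s.biUnion f = M := by
  classical
  induction s using Finset.induction_on generalizing M with
  | empty =>
    refine ⟨fun _ ↦ ∅, by simp, ?_⟩
    simp at h
    simp [h]
  | insert i s hi ih =>
    rw [sum_insert hi] at h
    obtain ⟨N, hNM, hN⟩ := exists_subset_card_eq (min_le_right (a i) #M)
    have hc : #(M \ N) ≤ ∑ i ∈ s, a i := by
      rw [card_sdiff_of_subset hNM]; omega
    obtain ⟨f, hf, hfM⟩ := ih (M \ N) hc
    refine ⟨Function.update f i N, fun j ↦ ?_, ?_⟩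
    · rcases eq_or_ne j i with rfl | hj
      · simp [hNM, hN]
      · simp only [Function.update_of_ne hj]
        exact ⟨(hf j).1.trans sdiff_subset, (hf j).2⟩
    · rw [biUnion_insert, Function.update_self]
      have : s.biUnion (Function.update f i N) = s.biUnion f :=
        biUnion_congr rfl fun j hj ↦ Function.update_of_ne (by rintro rfl; exact hi hj) _ _
      rw [this, hfM, union_sdiff_of_subset hNM]

/-- A set of size at most `n` avoiding `A` extends to one of size at most `n` which is as large
as possible, and together with `A` as large as possible. -/
theorem Finset.exists_superset_card_le {α : Type*} [Fintype α] [DecidableEq α]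
    (A M : Finset α) (n : ℕ) (hMA : M ⊆ Aᶜ) (hM : #M ≤ n) :
    ∃ E, M ⊆ E ∧ #E ≤ n ∧ min (Fintype.card α) n ≤ #E ∧
      min (Fintype.card α) (#A + n) ≤ #(A ∪ E) := by
  have hc : #Aᶜ = Fintype.card α - #A := card_compl A
  have hA := card_le_univ A
  have hMc := card_le_card hMA
  obtain ⟨F, hMF, hFA, hF⟩ := exists_subsuperset_card_eq hMA (n := min n #Aᶜ) (by omega) (by omega)
  obtain ⟨E, hFE, -, hE⟩ := exists_subsuperset_card_eq (subset_univ F)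
    (n := min n (Fintype.card α)) (by omega) (by simp)
  refine ⟨E, hMF.trans hFE, by omega, by omega, ?_⟩
  have h1 : #(A ∪ F) ≤ #(A ∪ E) := card_le_card (union_subset_union_right hFE)
  rw [card_union_of_disjoint (disjoint_left.2 fun x hx hxF ↦ by simpa [hx] using hFA hxF)] at h1
  omega

/-- Existence of the parent of a non-root vertex; uniqueness is `IsAcyclic.eq_of_adj_of_dist_eq`. -/
theorem SimpleGraph.Connected.exists_adj_dist_eq_add_one {V : Type*} {G : SimpleGraph V}
    (hG : G.Connected) {r u : V} (hu : G.dist r u ≠ 0) :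
    ∃ v, G.Adj v u ∧ G.dist r u = G.dist r v + 1 := by
  obtain ⟨p, hp⟩ := (hG r u).exists_walk_length_eq_dist
  have hnil : ¬ p.Nil := by
    rw [← SimpleGraph.Walk.length_eq_zero_iff]; omega
  have hadj : G.Adj p.penultimate u := p.adj_penultimate hnil
  refine ⟨p.penultimate, hadj, ?_⟩
  have h1 : G.dist r p.penultimate ≤ p.dropLast.length := G.dist_le _
  have h2 : G.dist r u ≤ G.dist r p.penultimate + G.dist p.penultimate u := hG.dist_triangle
  rw [SimpleGraph.dist_eq_one_iff_adj.2 hadj] at h2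
  have h3 : p.dropLast.length = p.length - 1 := by simp
  omega

open Classical in
/-- In a tree, if every closed neighborhood has total capacity at least `k`, then one can assign
to each vertex at most as many of `k` colours as its capacity, so that every closed neighborhood
sees all the colours. -/
theorem SimpleGraph.IsTree.exists_colouring_closedNeighborSet {V : Type*} [Fintype V]
    {G : SimpleGraph V} (hG : G.IsTree) (a : V → ℕ) (k : ℕ)
    (ha : ∀ v, k ≤ ∑ u with u ∈ G.closedNeighborSet v, a u) :
    ∃ C : V → Finset (Fin k), (∀ v, #(C v) ≤ a v) ∧
      ∀ v, (univ.filter (· ∈ G.closedNeighborSet v)).biUnion C = univ := by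
  have hconn := hG.connected
  obtain ⟨r⟩ := hconn.nonempty
  set d : V → ℕ := G.dist r with hd
  have hdr : ∀ v, d v = 0 ↔ r = v := fun v ↦ hconn.dist_eq_zero_iff
  have hadj : ∀ {u v}, G.Adj u v → d u = d v + 1 ∨ d v = d u + 1 :=
    fun h ↦ hG.dist_eq_dist_add_one_of_adj r h
  have hpar : ∀ u, ∃ v, d u ≠ 0 → G.Adj v u ∧ d u = d v + 1 := fun u ↦ by
    by_cases hu : d u = 0
    · exact ⟨u, fun h ↦ (h hu).elim⟩
    · obtain ⟨v, hv⟩ := hconn.exists_adj_dist_eq_add_one hu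
      exact ⟨v, fun _ ↦ hv⟩
  choose par hpar using hpar
  have huniq : ∀ {u v}, G.Adj v u → d u = d v + 1 → v = par u := fun {u v} h h' ↦
    have hu := hpar u (by omega)
    hG.isAcyclic.eq_of_adj_of_dist_eq (hconn r v) (hconn r _) h hu.1 h' hu.2
  have hN : ∀ {u v}, u ∈ G.closedNeighborSet v ↔ G.Adj v u ∨ u = v := by
    simp [SimpleGraph.closedNeighborSet, or_comm]
  set B : V → Finset V := fun v ↦ univ.filter fun u ↦ u ∈ G.closedNeighborSet v ∧ d u ≤ d v with hB
  set D : V → Finset V := fun v ↦ univ.filter fun u ↦ u ∈ G.closedNeighborSet v ∧ ¬ d u ≤ d v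
    with hD
  have hmemB : ∀ {u v}, u ∈ B v ↔ u ∈ G.closedNeighborSet v ∧ d u ≤ d v := by simp [hB]
  have hmemD : ∀ {u v}, u ∈ D v → d u = d v + 1 ∧ par u = v := by
    intro u v hu
    obtain ⟨h1, h2⟩ : u ∈ G.closedNeighborSet v ∧ ¬ d u ≤ d v := by simpa [hD] using hu
    rcases hN.1 h1 with h1 | rfl
    · have := hadj h1
      have h3 : d u = d v + 1 := by omega
      exact ⟨h3, (huniq h1 h3).symm⟩
    · exact (h2 le_rfl).elim
  have hB_pos : ∀ {v}, d v ≠ 0 → B v = {v, par v} := by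
    intro v hv
    obtain ⟨h1, h2⟩ := hpar v hv
    ext u
    rw [hmemB, hN, mem_insert, mem_singleton]
    constructor
    · rintro ⟨h | h, hle⟩
      · have := hadj h
        exact .inr (huniq h.symm (by omega))
      · exact .inl h
    · rintro (rfl | rfl)
      · exact ⟨.inr rfl, le_rfl⟩
      · exact ⟨.inl h1.symm, by omega⟩
  have hB_zero : ∀ {v}, d v = 0 → B v = {v} := by
    intro v hv
    ext u
    rw [hmemB, hN, mem_singleton]
    constructor
    · rintro ⟨-, hle⟩
      rw [← (hdr v).1 hv, ← (hdr u).1 (by omega)]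
    · rintro rfl
      exact ⟨.inr rfl, le_rfl⟩
  have hsum : ∀ v, ∑ u with u ∈ G.closedNeighborSet v, a u = ∑ u ∈ B v, a u + ∑ u ∈ D v, a u := by
    intro v
    rw [← sum_filter_add_sum_filter_not _ (fun u ↦ d u ≤ d v), filter_filter, filter_filter]
  -- Invariant: down to depth n, each vertex, alone and together with its parent, carries as many
  -- distinct colours as capacities allow. The colours `v` still misses then fit into its children.
  have key : ∀ n, ∃ C : V → Finset (Fin k),
      (∀ v, d v ≤ n → #(C v) ≤ a v ∧ min k (a v) ≤ #(C v) ∧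
        min k (∑ u ∈ B v, a u) ≤ #((B v).biUnion C)) ∧
      ∀ v, d v < n → (univ.filter (· ∈ G.closedNeighborSet v)).biUnion C = univ := by
    intro n
    induction n with
    | zero =>
      obtain ⟨E, -, h1, h2, -⟩ := exists_superset_card_le (α := Fin k) ∅ ∅ (a r) (by simp) (by simp)
      rw [Fintype.card_fin] at h2
      refine ⟨fun _ ↦ E, fun v hv ↦ ?_, by simp⟩
      have hv0 : d v = 0 := by omega
      have hrv := (hdr v).1 hv0
      subst hrv
      refine ⟨h1, h2, ?_⟩
      rw [hB_zero hv0]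
      simpa using h2
    | succ n ih =>
      obtain ⟨C, hC, hC'⟩ := ih
      have hE : ∀ v, ∃ E : V → Finset (Fin k), d v = n →
          ((B v).biUnion C)ᶜ ⊆ (D v).biUnion E ∧ ∀ u, #(E u) ≤ a u ∧ min k (a u) ≤ #(E u) ∧
            min k (#(C v) + a u) ≤ #(C v ∪ E u) := by
        intro v
        by_cases hv : d v = n
        swap
        · exact ⟨fun _ ↦ ∅, fun h ↦ (hv h).elim⟩
        have hcard : #((B v).biUnion C)ᶜ ≤ ∑ u ∈ D v, a u := by
          rw [card_compl, Fintype.card_fin]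
          have h1 := (hC v hv.le).2.2
          have h2 := ha v
          rw [hsum] at h2
          omega
        obtain ⟨f, hf, hfM⟩ := exists_biUnion_eq_of_card_le_sum (D v) a _ hcard
        -- The colours handed to a child avoid those of `v`, so serving `v` does not conflict with
        -- making the union of child and parent as large as possible.
        have hsub : ((B v).biUnion C)ᶜ ⊆ (C v)ᶜ :=
          compl_subset_compl.2 (subset_biUnion_of_mem C (hmemB.2 ⟨hN.2 (.inr rfl), le_rfl⟩))
        have hF := fun u ↦ exists_superset_card_le (C v) (f u) (a u) ((hf u).1.trans hsub) (hf u).2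
        choose E hE using hF
        simp only [Fintype.card_fin] at hE
        refine ⟨E, fun _ ↦ ⟨?_, fun u ↦ (hE u).2⟩⟩
        rw [← hfM]
        exact biUnion_mono fun u _ ↦ (hE u).1
      choose E hE using hE
      set C' : V → Finset (Fin k) := fun u ↦ if d u = n + 1 then E (par u) u else C u with hC'def
      have hold : ∀ u, d u ≤ n → C' u = C u := fun u hu ↦ if_neg (by omega)
      have hnew : ∀ u, d u = n + 1 → C' u = E (par u) u := fun u hu ↦ if_pos hu
      refine ⟨C', fun v hv ↦ ?_, fun v hv ↦ ?_⟩
      · rcases Nat.lt_or_ge n (d v) with h | h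
        · have hv' : d v = n + 1 := by omega
          have hp : d (par v) = n := by
            have := (hpar v (by omega)).2
            omega
          obtain ⟨h1, h2, h3⟩ := (hE _ hp).2 v
          rw [hnew v hv']
          refine ⟨h1, h2, ?_⟩
          have hne : v ≠ par v := by
            intro h
            rw [← h] at hp
            omega
          rw [hB_pos (by omega), sum_pair hne, biUnion_insert, singleton_biUnion, hnew v hv',
            hold _ hp.le, union_comm]
          have := (hC _ hp.le).2.1
          omega
        · rw [hold v h, biUnion_congr rfl fun u hu ↦ hold u ((hmemB.1 hu).2.trans h)]
          exact hC v h
      · rcases Nat.lt_or_ge (d v) n with h | h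
        · rw [← hC' v h]
          refine biUnion_congr rfl fun u hu ↦ hold u ?_
          rcases hN.1 (mem_filter.1 hu).2 with h' | rfl
          · have := hadj h'
            omega
          · exact h.le
        · have hvn : d v = n := by omega
          refine eq_univ_iff_forall.2 fun x ↦ ?_
          by_cases hx : x ∈ (B v).biUnion C
          · obtain ⟨u, hu, hxu⟩ := mem_biUnion.1 hx
            obtain ⟨h1, h2⟩ := hmemB.1 hu
            exact mem_biUnion.2 ⟨u, by simpa using h1, by rwa [hold u (by omega)]⟩
          · obtain ⟨u, hu, hxu⟩ := mem_biUnion.1 ((hE v hvn).1 (mem_compl.2 hx))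
            obtain ⟨h1, h2⟩ := hmemD hu
            refine mem_biUnion.2 ⟨u, ?_, by rwa [hnew u (by omega), h2]⟩
            exact mem_filter.2 ⟨mem_univ _, (mem_filter.1 hu).2.1⟩
  -- Coverage holds only strictly above level n, so go one level past the deepest vertex.
  obtain ⟨C, h1, h2⟩ := key (univ.sup d + 1)
  have hle : ∀ v, d v ≤ univ.sup d := fun v ↦ le_sup (mem_univ v)
  exact ⟨C, fun v ↦ (h1 v ((hle v).trans (Nat.le_succ _))).1, fun v ↦ h2 v (Nat.lt_succ_of_le (hle v))⟩

/-! ### Ideals defined by the weighted order -/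

namespace MvPolynomial

variable {σ K : Type*} [Field K]

variable (K) in
/-- The ideal of polynomials all of whose monomials have weight at least `k`. -/
noncomputable def weightIdeal (w : σ → ℕ) (k : ℕ) : Ideal (MvPolynomial σ K) where
  carrier := {f | (k : ℕ∞) ≤ (f : MvPowerSeries σ K).weightedOrder w}
  zero_mem' := by simp
  add_mem' {f g} hf hg := by
    simp only [Set.mem_ofPred_eq, coe_add] at *
    exact (le_min hf hg).trans (MvPowerSeries.min_weightedOrder_le_add w)
  smul_mem' c f hf := by
    simp only [Set.mem_ofPred_eq, smul_eq_mul, coe_mul] at *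
    exact (hf.trans le_add_self).trans (MvPowerSeries.le_weightedOrder_mul w)

theorem mem_weightIdeal {w : σ → ℕ} {k : ℕ} {f : MvPolynomial σ K} :
    f ∈ weightIdeal K w k ↔ (k : ℕ∞) ≤ (f : MvPowerSeries σ K).weightedOrder w := Iff.rfl

theorem mem_weightIdeal_iff_support {w : σ → ℕ} {k : ℕ} {f : MvPolynomial σ K} :
    f ∈ weightIdeal K w k ↔ ∀ m ∈ f.support, k ≤ Finsupp.weight w m := by
  rw [mem_weightIdeal]
  constructor
  · intro h m hm
    have := h.trans (MvPowerSeries.weightedOrder_le w (d := m)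
      (by rwa [coeff_coe, ← mem_support_iff]))
    exact_mod_cast this
  · intro h
    refine MvPowerSeries.nat_le_weightedOrder w fun m hm ↦ ?_
    rw [coeff_coe]
    by_contra hne
    exact hm.not_ge (h m (mem_support_iff.2 hne))

theorem mul_mem_weightIdeal {w : σ → ℕ} {k l : ℕ} {f g : MvPolynomial σ K}
    (hf : f ∈ weightIdeal K w k) (hg : g ∈ weightIdeal K w l) :
    f * g ∈ weightIdeal K w (k + l) := by
  rw [mem_weightIdeal] at *
  rw [coe_mul, MvPowerSeries.weightedOrder_mul, Nat.cast_add]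
  exact add_le_add hf hg

theorem weightIdeal_zero (w : σ → ℕ) : weightIdeal K w 0 = ⊤ :=
  (Ideal.eq_top_iff_one _).2 (mem_weightIdeal.2 (by simp))

theorem weightIdeal_one_pow_le (w : σ → ℕ) (k : ℕ) :
    weightIdeal K w 1 ^ k ≤ weightIdeal K w k := by
  induction k with
  | zero => simp [weightIdeal_zero]
  | succ k ih =>
    rw [pow_succ]
    exact Ideal.mul_le.2 fun f hf g hg ↦ mul_mem_weightIdeal (ih hf) hg

/-- The primary property: weighted orders add under multiplication over a field. -/
theorem mem_weightIdeal_one_of_mul_mem {w : σ → ℕ} {k : ℕ} {f g : MvPolynomial σ K}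
    (hf : f ∉ weightIdeal K w k) (hfg : f * g ∈ weightIdeal K w k) : g ∈ weightIdeal K w 1 := by
  rw [mem_weightIdeal] at *
  rw [coe_mul, MvPowerSeries.weightedOrder_mul] at hfg
  rw [Nat.cast_one, Order.one_le_iff_ne_zero]
  intro h
  rw [h, add_zero] at hfg
  exact hf hfg

theorem weightIdeal_one_isPrime (w : σ → ℕ) : (weightIdeal K w 1).IsPrime where
  ne_top' := by
    rw [Ideal.ne_top_iff_one, mem_weightIdeal, coe_one, MvPowerSeries.weightedOrder_one]
    simp
  mem_or_mem' {f g} h := by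
    by_cases hf : f ∈ weightIdeal K w 1
    · exact .inl hf
    · exact .inr (mem_weightIdeal_one_of_mul_mem hf h)

theorem X_mem_weightIdeal_one {w : σ → ℕ} {i : σ} :
    (X i : MvPolynomial σ K) ∈ weightIdeal K w 1 ↔ 1 ≤ w i := by
  classical
  rw [mem_weightIdeal_iff_support, support_X]
  simp [Finsupp.weight_single]

theorem weightIdeal_mono [Fintype σ] {w w' : σ → ℕ} (h : w ≤ w') (k : ℕ) :
    weightIdeal K w k ≤ weightIdeal K w' k := by
  intro f hf
  rw [mem_weightIdeal_iff_support] at *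
  intro m hm
  refine (hf m hm).trans ?_
  simp only [Finsupp.weight_eq_sum]
  exact sum_le_sum fun i _ ↦ Nat.mul_le_mul_left _ (h i)

end MvPolynomial

/-! ### Powers of the dominating ideal of a tree -/

namespace SimpleGraph

open MvPolynomial

variable {V : Type*} (K : Type*) [Field K] (G : SimpleGraph V)

/-- The indicator function of the closed neighborhood of `v`. -/
noncomputable def closedNeighborWeight (v : V) : V → ℕ :=
  (G.closedNeighborSet v).indicator 1

variable {G} in
theorem one_le_closedNeighborWeight {u v : V} :
    1 ≤ G.closedNeighborWeight v u ↔ u ∈ G.closedNeighborSet v := by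
  classical
  simp only [closedNeighborWeight, Set.indicator_apply]
  split_ifs with h <;> simp [h]

open Classical in
theorem weight_closedNeighborWeight [Fintype V] (v : V) (m : V →₀ ℕ) :
    Finsupp.weight (G.closedNeighborWeight v) m = ∑ u with u ∈ G.closedNeighborSet v, m u := by
  simp [Finsupp.weight_eq_sum, closedNeighborWeight, Set.indicator_apply, sum_filter]

variable {G} in
theorem IsDominatingSet.prod_X_mem [Finite V] {S : Finset V} (hS : G.IsDominatingSet S) :
    ∏ i ∈ S, (X i : MvPolynomial V K) ∈ G.dominatingIdeal K := by
  classical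
  obtain ⟨T, hTS, hT⟩ := Set.Finite.exists_le_minimal (Set.toFinite {S | G.IsDominatingSet S}) hS
  rw [← prod_sdiff hTS]
  exact Ideal.mul_mem_left _ _ (Ideal.subset_span ⟨T, hT, rfl⟩)

theorem dominatingIdeal_le_weightIdeal (v : V) :
    G.dominatingIdeal K ≤ weightIdeal K (G.closedNeighborWeight v) 1 := by
  refine Ideal.span_le.2 ?_
  rintro _ ⟨S, hS, rfl⟩
  obtain ⟨u, huS, hu⟩ := hS.1 v
  exact Ideal.mem_of_dvd _ (dvd_prod_of_mem _ huS)
    (X_mem_weightIdeal_one.2 (one_le_closedNeighborWeight.2 hu))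

variable {G} in
-- With the exponents as capacities, each of the k colour classes is dominating, and `i` lies in
-- `#(C i) ≤ m i` of them.
theorem IsTree.monomial_mem_dominatingIdeal_pow [Fintype V] (hG : G.IsTree) {k : ℕ} {m : V →₀ ℕ}
    (hm : ∀ v, k ≤ Finsupp.weight (G.closedNeighborWeight v) m) (c : K) :
    monomial m c ∈ G.dominatingIdeal K ^ k := by
  classical
  obtain ⟨C, hC, hC'⟩ := hG.exists_colouring_closedNeighborSet m k fun v ↦ by
    convert hm v using 1
    rw [weight_closedNeighborWeight]
  let S : Fin k → Finset V := fun j ↦ univ.filter fun v ↦ j ∈ C v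
  have hS : ∀ j, G.IsDominatingSet (S j) := by
    intro j v
    have hj : j ∈ (univ.filter (· ∈ G.closedNeighborSet v)).biUnion C := by
      convert mem_univ j using 1
      convert hC' v using 2
    obtain ⟨u, hu, huj⟩ := mem_biUnion.1 hj
    exact ⟨u, by simpa [S] using huj, (mem_filter.1 hu).2⟩
  have hprod : ∏ j, ∏ i ∈ S j, (X i : MvPolynomial V K) ∈ G.dominatingIdeal K ^ k := by
    have := Ideal.prod_mem_prod (s := (univ : Finset (Fin k))) (I := fun _ ↦ G.dominatingIdeal K)
      (x := fun j ↦ ∏ i ∈ S j, (X i : MvPolynomial V K)) fun j _ ↦ (hS j).prod_X_mem K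
    simpa using this
  refine Ideal.mem_of_dvd _ ?_ hprod
  have hswap : ∏ j, ∏ i ∈ S j, (X i : MvPolynomial V K) = ∏ i, X i ^ #(C i) := by
    simp only [S, prod_filter]
    rw [prod_comm]
    refine prod_congr rfl fun i _ ↦ ?_
    rw [← prod_filter, prod_const]
    simp
  rw [hswap, monomial_eq, Finsupp.prod_fintype _ _ (by simp)]
  exact Dvd.dvd.mul_left (prod_dvd_prod_of_dvd _ _ fun i _ ↦ pow_dvd_pow _ (hC i)) _

variable {G} in
theorem IsTree.mem_dominatingIdeal_pow_iff [Fintype V] (hG : G.IsTree) {k : ℕ}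
    {f : MvPolynomial V K} :
    f ∈ G.dominatingIdeal K ^ k ↔ ∀ v, f ∈ weightIdeal K (G.closedNeighborWeight v) k := by
  constructor
  · intro hf v
    exact weightIdeal_one_pow_le _ _
      (Ideal.pow_right_mono (G.dominatingIdeal_le_weightIdeal K v) k hf)
  · intro hf
    rw [f.as_sum]
    exact Ideal.sum_mem _ fun m hm ↦ hG.monomial_mem_dominatingIdeal_pow K
      (fun v ↦ mem_weightIdeal_iff_support.1 (hf v) m hm) _

end SimpleGraph

open MvPolynomial in
theorem corollary2 {V : Type*} [Finite V] (K : Type*) [Field K]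
    (G : SimpleGraph V) (hG : G.IsTree) :
    (G.dominatingIdeal K).IsNormallyTorsionFree := by
  classical
  have := Fintype.ofFinite V
  intro k hk p hp
  obtain ⟨hprime, x, hx⟩ := isAssociatedPrime_iff.1 hp
  obtain ⟨x, rfl⟩ := Ideal.Quotient.mk_surjective x
  set Q : V → ℕ → Ideal (MvPolynomial V K) := fun v ↦ weightIdeal K (G.closedNeighborWeight v)
  have hmem : ∀ y, y ∈ p ↔ ∀ v, x * y ∈ Q v k := by
    intro y
    rw [hx, Submodule.mem_colon_singleton, Submodule.mem_bot, ← hG.mem_dominatingIdeal_pow_iff K,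
      ← Ideal.Quotient.eq_zero_iff_mem, mul_comm, map_mul]
    rfl
  have hle : ∀ v, x ∉ Q v k → p ≤ Q v 1 := fun v hv y hy ↦
    mem_weightIdeal_one_of_mul_mem hv ((hmem y).1 hy v)
  -- Otherwise each `v` has a multiplier outside `p` taking `x` into `Q v k`; the product of these
  -- lies in the prime `p`.
  obtain ⟨v, hxv, hvp⟩ : ∃ v, x ∉ Q v k ∧ Q v 1 ≤ p := by
    by_contra! h
    have h' : ∀ v, ∃ y, x * y ∈ Q v k ∧ y ∉ p := by
      intro v
      by_cases hv : x ∈ Q v k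
      · exact ⟨1, by simpa using hv, (Ideal.ne_top_iff_one p).1 hprime.ne_top⟩
      · obtain ⟨z, hz, hzp⟩ := SetLike.not_le_iff_exists.1 (h v hv)
        refine ⟨z ^ k, Ideal.mul_mem_left _ _ ?_, fun hzk ↦ hzp (hprime.mem_of_pow_mem _ hzk)⟩
        exact weightIdeal_one_pow_le _ _ (Ideal.pow_mem_pow hz k)
    choose y hy hyp using h'
    have hprod : ∏ v, y v ∈ p := (hmem _).2 fun v ↦ by
      rw [← mul_prod_erase univ y (mem_univ v), ← mul_assoc]
      exact Ideal.mul_mem_right _ _ (hy v)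
    obtain ⟨v, -, hv⟩ := (hprime.prod_mem_iff).1 hprod
    exact hyp v hv
  have hpv : p = Q v 1 := (hle v hxv).antisymm hvp
  have hI : ∀ f, f ∈ G.dominatingIdeal K ↔ ∀ u, f ∈ Q u 1 := fun f ↦ by
    simpa using hG.mem_dominatingIdeal_pow_iff K (k := 1) (f := f)
  -- Here N[u] ⊆ N[v], so `Q u k ≤ Q v k` and `x` is outside `Q u k` too.
  have hmin : ∀ u, Q u 1 ≤ p → p ≤ Q u 1 := by
    intro u hu
    refine hle u fun hxu ↦ hxv (weightIdeal_mono (fun i ↦ ?_) k hxu)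
    by_cases hi : i ∈ G.closedNeighborSet u
    · have h1 : (X i : MvPolynomial V K) ∈ Q v 1 :=
        hpv ▸ hu (X_mem_weightIdeal_one.2 (SimpleGraph.one_le_closedNeighborWeight.2 hi))
      have h2 := SimpleGraph.one_le_closedNeighborWeight.1 (X_mem_weightIdeal_one.1 h1)
      simp [SimpleGraph.closedNeighborWeight, hi, h2]
    · simp [SimpleGraph.closedNeighborWeight, hi]
  refine Module.associatedPrimes.minimalPrimes_annihilator_subset_associatedPrimes _ _ ?_
  rw [Ideal.annihilator_quotient]
  refine ⟨⟨hprime, fun f hf ↦ hvp ((hI f).1 hf v)⟩, fun q hq hqp ↦ ?_⟩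
  -- A prime containing a finite intersection of ideals contains one of them.
  obtain ⟨u, hu⟩ : ∃ u, Q u 1 ≤ q := by
    by_contra! h
    choose y hy hyq using fun u ↦ SetLike.not_le_iff_exists.1 (h u)
    have hprod : ∏ u, y u ∈ q := hq.2 ((hI _).2 fun u ↦
      Ideal.mem_of_dvd _ (dvd_prod_of_mem y (mem_univ u)) (hy u))
    obtain ⟨u, -, hu⟩ := (hq.1.prod_mem_iff).1 hprod
    exact hyq u hu
  exact (hmin u (hu.trans hqp)).trans hu
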